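/- For $n\ge 0$ let $f:\{0,1\}^n\to\{0,1\}$ be drawn uniformly at random from the set of all boolean functions on $n$ bits. For a boolean function $g$ on $n$ bits let $$I[g]=\frac1{2^n}\sum_{x\in\{0,1\}^n}\#\{i: g(x)\ne g(x^{\oplus i})\}$$ be its average sensitivity (total influence), where $x^{\oplus i}$ is $x$ with the $i$-th bit flipped. For $p\in[0,1]$, identify the output bits $0,1$ with $1,-1$, let $$T_{1-2p}f(x)=\mathbb{E}[f(Z)\mid X=x]=\sum_{z\in\{0,1\}^n}p^{d(x,z)}(1-p)^{n-d(x,z)}f(z)$$ be the noise operator, where $Z$ arises from $x$ by flipping each bit independently with probability $p$ and $d$ is the Hamming distance, and let $f_N^*=\operatorname{sign}(T_{1-2p}f)$. Here $\operatorname{sign}(0)\in\{1,-1\}$ is fixed once and for all; either choice is allowed. Then: 1. For every fixed $p\in[0,1]$, as $n\to\infty$, $$\mathbb{E}_f\big[I[f_N^*]\big]\sim\frac n\pi\arccos\!\left(\frac{2p(1-p)}{p^2+(1-p)^2}\right),$$ where $a_n\sim b_n$ means $a_n-b_n=o(b_n)$ (for $p=1/2$ the right-hand side is $0$, and the claim is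 that the left-hand side is $0$ for all large $n$). 2. For every $n$, $\mathbb{E}_f[I[f]]=n/2$. 3. For every $p\in(0,1/2]$ there is $n_0$ (depending on $p$) such that $\mathbb{E}_f[I[f]]>\mathbb{E}_f[I[f_N^*]]$ for all $n\ge n_0$. -/

import Mathlib

open scoped BigOperators

noncomputable section

/-- Boolean functions on `n` bits; as a finite type, it carries the uniform average `𝔼 f`. -/
abbrev BoolFun (n : ℕ) : Type := (Fin n → Bool) → Bool

/-- The bit string `x` with its `i`-th bit flipped. -/
def flipBit {n : ℕ} (i : Fin n) (x : Fin n → Bool) : Fin n → Bool :=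
  Function.update x i (!(x i))

/-- The sensitivity of `f` at `x`: the number of positions whose flip changes the value of `f`. -/
def sensitivityAt {n : ℕ} (f : BoolFun n) (x : Fin n → Bool) : ℕ :=
  (Finset.univ.filter fun i : Fin n => f x ≠ f (flipBit i x)).card

/-- The average sensitivity (total influence) of `f`: the mean of the sensitivity over a uniformly
random input. -/
def avgSensitivity {n : ℕ} (f : BoolFun n) : ℝ :=
  𝔼 x : Fin n → Bool, (sensitivityAt f x : ℝ)

/-- The `±1` representation of a bit: `0 ↦ 1` and `1 ↦ -1`. -/
def pmOne (b : Bool) : ℝ := if b then -1 else 1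

/-- The probability `Pr(Z = z | X = x)` when the bits of `x` are flipped independently so that each
bit, in the `±1` representation, has correlation `ρ` with its noisy copy: a bit is kept with
probability `(1 + ρ) / 2` and flipped with probability `(1 - ρ) / 2`. For `ρ = 1 - 2 * p` the
flip probability is `p`. -/
def noiseKernel {n : ℕ} (ρ : ℝ) (x z : Fin n → Bool) : ℝ :=
  ∏ i : Fin n, if z i = x i then (1 + ρ) / 2 else (1 - ρ) / 2

/-- The noise operator `T_ρ g (x) = E[g(Z) | X = x]`. -/
def noiseOp {n : ℕ} (ρ : ℝ) (g : (Fin n → Bool) → ℝ) (x : Fin n → Bool) : ℝ :=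
  ∑ z : Fin n → Bool, noiseKernel ρ x z * g z

/-- The sign of a real number as a bit, the bit `b` standing for the value `pmOne b`.
The argument `tie` is the bit assigned to `0`. -/
def signBit (tie : Bool) (t : ℝ) : Bool :=
  if 0 < t then false else if t < 0 then true else tie

/-- The optimal predictor `sign (T_{1-2p} f)` for data whose bits are flipped with
probability `p`. -/
def optPredictor {n : ℕ} (tie : Bool) (p : ℝ) (f : BoolFun n) : BoolFun n :=
  fun x => signBit tie (noiseOp (1 - 2 * p) (fun z => pmOne (f z)) x)

end

/-!
Fix neighbouring inputs `x` and `x^{⊕i}` and write `r = 1 - 2p`. Over a uniformly random `f`, the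
pair `(T_r f(x), T_r f(x^{⊕i}))` is a sum of independent Rademacher variables with planar
coefficients `(K_r(x, z), K_r(x^{⊕i}, z))`. Since `T_r` is symmetric and `T_r ∘ T_r = T_{r²}`, its
coordinates have correlation `ρ = (1 - r²) / (1 + r²)`. After normalisation each coefficient is
exponentially small unless `|r| = 1`, so by the central limit theorem the pair is asymptotically a
bivariate Gaussian of correlation `ρ`, whose coordinates have opposite signs with probability
`arccos ρ / π` (Sheppard): by rotation invariance the direction of a standard Gaussian vector is
uniform. Averaging over `x` and `i` gives the asymptotics. For `|r| = 1` the operator `T_r` only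
permutes the values of `f`, and for `r = 0` the predictor is constant.
-/

open Filter MeasureTheory ProbabilityTheory
open scoped Topology RealInnerProductSpace

/-! ### Expected average sensitivity -/

theorem flipBit_ne {n : ℕ} (i : Fin n) (x : Fin n → Bool) : flipBit i x ≠ x := by
  simp [flipBit]

/-- The probability, over a uniformly random `f`, that `Φ f` is sensitive to the `i`-th bit at
the input `x`. -/
noncomputable def flipProb {n : ℕ} (Φ : BoolFun n → BoolFun n) (x : Fin n → Bool) (i : Fin n) : ℝ :=
  𝔼 f, if Φ f x ≠ Φ f (flipBit i x) then 1 else 0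

theorem expect_avgSensitivity {n : ℕ} (Φ : BoolFun n → BoolFun n) :
    𝔼 f, avgSensitivity (Φ f) = n * 𝔼 q : (Fin n → Bool) × Fin n, flipProb Φ q.1 q.2 := by
  have hx : ∀ x, 𝔼 f, (sensitivityAt (Φ f) x : ℝ) = ∑ i, flipProb Φ x i := fun x => by
    simp only [sensitivityAt, Finset.natCast_card_filter, Finset.expect_sum_comm, flipProb]
  calc 𝔼 f, avgSensitivity (Φ f)
      = 𝔼 x, 𝔼 f, (sensitivityAt (Φ f) x : ℝ) := Finset.expect_comm ..
    _ = 𝔼 x, n * 𝔼 i, flipProb Φ x i := by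
        simp only [hx, ← Fintype.card_mul_expect, Fintype.card_fin]
    _ = n * 𝔼 q : (Fin n → Bool) × Fin n, flipProb Φ q.1 q.2 := by
        rw [← Finset.mul_expect, ← Finset.univ_product_univ, Finset.expect_product]

theorem expect_ne_eq_half {α : Type*} [Fintype α] [DecidableEq α] {u v : α} (h : u ≠ v) :
    (𝔼 f : α → Bool, if f u ≠ f v then (1 : ℝ) else 0) = 1 / 2 := by
  have toggle : Function.Involutive fun f : α → Bool => Function.update f u (!f u) := fun f => by
    simp
  have hswap : (𝔼 f : α → Bool, if f u ≠ f v then (1 : ℝ) else 0) =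
      𝔼 f : α → Bool, (1 - if f u ≠ f v then (1 : ℝ) else 0) := by
    refine Fintype.expect_equiv toggle.toPerm _ _ fun f => ?_
    simp only [Function.Involutive.coe_toPerm, Function.update_self, Function.update_of_ne h.symm]
    cases f u <;> cases f v <;> simp
  rw [Finset.expect_sub_distrib, Fintype.expect_const] at hswap
  linarith

theorem expect_avgSensitivity_comp {n : ℕ} {Φ : BoolFun n → BoolFun n}
    {σ : (Fin n → Bool) → Fin n → Bool} (hσ : σ.Injective) (hΦ : ∀ f x, Φ f x = f (σ x)) :
    𝔼 f, avgSensitivity (Φ f) = (n : ℝ) / 2 := by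
  have hflip : ∀ x i, flipProb Φ x i = 1 / 2 := fun x i => by
    simpa only [flipProb, hΦ] using expect_ne_eq_half (hσ.ne (flipBit_ne i x).symm)
  rcases n.eq_zero_or_pos with rfl | hn
  · simp [expect_avgSensitivity]
  · have : Nonempty (Fin n) := ⟨⟨0, hn⟩⟩
    simp only [expect_avgSensitivity, hflip, Fintype.expect_const]
    ring

/-- Evaluating along the selections that maximise and minimise each `F n` turns pointwise limits
along arbitrary selections into a limit of averages. -/
theorem tendsto_expect_of_forall_tendsto {ι : ℕ → Type*} [∀ n, Fintype (ι n)]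
    [∀ n, Nonempty (ι n)] {F : ∀ n, ι n → ℝ} {L : ℝ}
    (h : ∀ q : ∀ n, ι n, Tendsto (fun n => F n (q n)) atTop (𝓝 L)) :
    Tendsto (fun n => 𝔼 i, F n i) atTop (𝓝 L) := by
  choose lo hlo using fun n => Finite.exists_min (F n)
  choose hi hhi using fun n => Finite.exists_max (F n)
  exact tendsto_of_tendsto_of_tendsto_of_le_of_le (h lo) (h hi)
    (fun n => Finset.le_expect Finset.univ_nonempty fun i _ => hlo n i)
    fun n => Finset.expect_le Finset.univ_nonempty fun i _ => hhi n i

/-! ### A central limit theorem for weighted Rademacher sums -/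

theorem norm_prod_sub_prod_le_sum {ι R : Type*} [NormedCommRing R] [NormOneClass R]
    (s : Finset ι) {a b : ι → R} (ha : ∀ i ∈ s, ‖a i‖ ≤ 1) (hb : ∀ i ∈ s, ‖b i‖ ≤ 1) :
    ‖∏ i ∈ s, a i - ∏ i ∈ s, b i‖ ≤ ∑ i ∈ s, ‖a i - b i‖ := by
  classical
  induction s using Finset.induction_on with
  | empty => simp
  | insert j s hj ih =>
    rw [Finset.forall_mem_insert] at ha hb
    have hB : ‖∏ i ∈ s, b i‖ ≤ 1 :=
      (Finset.norm_prod_le _ _).trans (Finset.prod_le_one (fun _ _ => norm_nonneg _) hb.2)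
    rw [Finset.prod_insert hj, Finset.prod_insert hj, Finset.sum_insert hj]
    calc ‖a j * ∏ i ∈ s, a i - b j * ∏ i ∈ s, b i‖
        = ‖(a j - b j) * ∏ i ∈ s, b i + a j * (∏ i ∈ s, a i - ∏ i ∈ s, b i)‖ := by ring_nf
      _ ≤ ‖a j - b j‖ * ‖∏ i ∈ s, b i‖ + ‖a j‖ * ‖∏ i ∈ s, a i - ∏ i ∈ s, b i‖ :=
        (norm_add_le _ _).trans (add_le_add (norm_mul_le _ _) (norm_mul_le _ _))
      _ ≤ ‖a j - b j‖ * 1 + 1 * ∑ i ∈ s, ‖a i - b i‖ := by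
        gcongr
        exacts [ha.1, ih ha.2 hb.2]
      _ = ‖a j - b j‖ + ∑ i ∈ s, ‖a i - b i‖ := by ring

theorem abs_cos_sub_exp_le (x : ℝ) : |Real.cos x - Real.exp (-(x ^ 2 / 2))| ≤ 2 * x ^ 4 := by
  rcases le_total |x| 1 with hx | hx
  · have hsq : x ^ 2 ≤ 1 := (sq_le_one_iff_abs_le_one x).2 hx
    have hcos : |Real.cos x - (1 - x ^ 2 / 2)| ≤ x ^ 4 := by
      refine (Real.cos_bound hx).trans ?_
      rw [Even.pow_abs (by decide)]
      exact mul_le_of_le_one_right (by positivity) (by norm_num)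
    have hexp : |Real.exp (-(x ^ 2 / 2)) - (1 - x ^ 2 / 2)| ≤ x ^ 4 := by
      have h := Real.abs_exp_sub_one_sub_id_le (x := -(x ^ 2 / 2))
        (by rw [abs_neg, abs_of_nonneg (by positivity)]; linarith)
      calc _ = |Real.exp (-(x ^ 2 / 2)) - 1 - -(x ^ 2 / 2)| := by ring_nf
        _ ≤ (-(x ^ 2 / 2)) ^ 2 := h
        _ ≤ x ^ 4 := by nlinarith [sq_nonneg (x ^ 2)]
    rw [abs_sub_comm] at hexp
    linarith [abs_sub_le (Real.cos x) (1 - x ^ 2 / 2) (Real.exp (-(x ^ 2 / 2)))]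
  · have hx4 : 1 ≤ x ^ 4 := by
      rw [← Even.pow_abs (by decide)]
      exact one_le_pow₀ hx
    have hexp : |Real.exp (-(x ^ 2 / 2))| ≤ 1 := by
      rw [Real.abs_exp, Real.exp_le_one_iff]
      exact neg_nonpos.2 (by positivity)
    linarith [abs_sub (Real.cos x) (Real.exp (-(x ^ 2 / 2))), Real.abs_cos_le_one x]

theorem abs_prod_cos_sub_exp_le {ι : Type*} [Fintype ι] {c : ι → ℝ} {δ : ℝ}
    (hc : ∀ i, |c i| ≤ δ) :
    |∏ i, Real.cos (c i) - Real.exp (-((∑ i, c i ^ 2) / 2))| ≤ 2 * δ ^ 2 * ∑ i, c i ^ 2 := by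
  have hexp : Real.exp (-((∑ i, c i ^ 2) / 2)) = ∏ i, Real.exp (-(c i ^ 2 / 2)) := by
    rw [← Real.exp_sum, Finset.sum_neg_distrib, Finset.sum_div]
  rw [hexp, Finset.mul_sum]
  refine (norm_prod_sub_prod_le_sum (R := ℝ) _ (fun i _ => ?_) fun i _ => ?_).trans
    (Finset.sum_le_sum fun i _ => ?_)
  · exact Real.abs_cos_le_one _
  · rw [Real.norm_eq_abs, Real.abs_exp, Real.exp_le_one_iff]
    exact neg_nonpos.2 (by positivity)
  · have hsq : c i ^ 2 ≤ δ ^ 2 := sq_le_sq.2 ((hc i).trans (le_abs_self δ))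
    calc |Real.cos (c i) - Real.exp (-(c i ^ 2 / 2))| ≤ 2 * (c i ^ 2 * c i ^ 2) :=
          (abs_cos_sub_exp_le (c i)).trans_eq (by ring)
      _ ≤ 2 * (δ ^ 2 * c i ^ 2) := by gcongr
      _ = 2 * δ ^ 2 * c i ^ 2 := by ring

theorem tendsto_prod_cos {ι : ℕ → Type*} [∀ n, Fintype (ι n)] {c : ∀ n, ι n → ℝ} {δ : ℕ → ℝ}
    {v : ℝ} (hc : ∀ n i, |c n i| ≤ δ n) (hδ : Tendsto δ atTop (𝓝 0))
    (hv : Tendsto (fun n => ∑ i, c n i ^ 2) atTop (𝓝 v)) :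
    Tendsto (fun n => ∏ i, Real.cos (c n i)) atTop (𝓝 (Real.exp (-(v / 2)))) := by
  have hexp : Tendsto (fun n => Real.exp (-((∑ i, c n i ^ 2) / 2))) atTop
      (𝓝 (Real.exp (-(v / 2)))) := (hv.div_const 2).neg.rexp
  have herr : Tendsto (fun n => ∏ i, Real.cos (c n i) - Real.exp (-((∑ i, c n i ^ 2) / 2))) atTop
      (𝓝 0) := by
    refine squeeze_zero_norm (fun n => abs_prod_cos_sub_exp_le (hc n)) ?_
    simpa using ((hδ.pow 2).const_mul 2).mul hv
  simpa using herr.add hexp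

theorem expect_prod_apply {ι κ K : Type*} [Fintype ι] [DecidableEq ι] [Fintype κ] [Field K]
    [CharZero K] (g : ι → κ → K) : 𝔼 f : ι → κ, ∏ i, g i (f i) = ∏ i, 𝔼 b, g i b := by
  simp only [Fintype.expect_eq_sum_div_card, Finset.prod_div_distrib, Fintype.prod_sum,
    Fintype.card_fun, Finset.prod_const, Finset.card_univ, Nat.cast_pow]

theorem expect_exp_pmOne_mul_I (c : ℝ) :
    𝔼 b, Complex.exp ((pmOne b * c : ℝ) * Complex.I) = Real.cos c := by
  rw [Fintype.expect_eq_sum_div_card, Fintype.sum_bool, Complex.ofReal_cos, Complex.cos]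
  simp [pmOne, add_comm]

theorem integral_uniformOfFintype {Ω 𝕜 : Type*} [Fintype Ω] [Nonempty Ω] [MeasurableSpace Ω]
    [MeasurableSingletonClass Ω] [RCLike 𝕜] (g : Ω → 𝕜) :
    ∫ ω, g ω ∂(PMF.uniformOfFintype Ω).toMeasure = 𝔼 ω, g ω := by
  simp only [PMF.integral_eq_sum, PMF.uniformOfFintype_apply, Fintype.expect_eq_sum_div_card,
    ENNReal.toReal_inv, ENNReal.toReal_natCast, RCLike.real_smul_eq_coe_mul, RCLike.ofReal_inv,
    RCLike.ofReal_natCast, inv_mul_eq_div, Finset.sum_div]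

section RademacherLaw

variable {ι E : Type*} [Fintype ι] [DecidableEq ι] [MeasurableSpace E]

section Module

variable [AddCommMonoid E] [Module ℝ E]

/-- The law of the Rademacher sum `∑ i, ε i • a i`, where the `ε i` are independent uniform
signs. -/
noncomputable def rademacherLaw (a : ι → E) : Measure E :=
  (PMF.uniformOfFintype (ι → Bool)).toMeasure.map fun f => ∑ i, pmOne (f i) • a i

instance isProbabilityMeasure_rademacherLaw (a : ι → E) :
    IsProbabilityMeasure (rademacherLaw a) :=
  Measure.isProbabilityMeasure_map Measurable.of_discrete.aemeasurable

theorem rademacherLaw_real_apply (a : ι → E) {s : Set E} (hs : MeasurableSet s) :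
    (rademacherLaw a).real s = 𝔼 f : ι → Bool, s.indicator 1 (∑ i, pmOne (f i) • a i) := by
  rw [← integral_indicator_one hs, rademacherLaw, integral_map Measurable.of_discrete.aemeasurable
    (stronglyMeasurable_one.indicator hs).aestronglyMeasurable, integral_uniformOfFintype]

end Module

theorem charFun_rademacherLaw [NormedAddCommGroup E] [InnerProductSpace ℝ E]
    [OpensMeasurableSpace E] (a : ι → E) (t : E) :
    charFun (rademacherLaw a) t = ((∏ i, Real.cos ⟪a i, t⟫ : ℝ) : ℂ) := by
  rw [charFun_apply, rademacherLaw, integral_map Measurable.of_discrete.aemeasurable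
    (by fun_prop), integral_uniformOfFintype]
  simp only [Complex.ofReal_prod, ← expect_exp_pmOne_mul_I, ← expect_prod_apply, ← Complex.exp_sum]
  refine Finset.expect_congr rfl fun f _ => ?_
  simp only [sum_inner, real_inner_smul_left, Complex.ofReal_sum, Finset.sum_mul]

end RademacherLaw

theorem tendsto_rademacherLaw {E : Type*} [NormedAddCommGroup E] [InnerProductSpace ℝ E]
    [FiniteDimensional ℝ E] [MeasurableSpace E] [BorelSpace E] {ι : ℕ → Type*}
    [∀ n, Fintype (ι n)] [∀ n, DecidableEq (ι n)] {a : ∀ n, ι n → E} {δ : ℕ → ℝ}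
    {μ : Measure E} [IsGaussian μ] (hμ : μ[id] = 0) (ha : ∀ n i, ‖a n i‖ ≤ δ n)
    (hδ : Tendsto δ atTop (𝓝 0))
    (hcov : ∀ t, Tendsto (fun n => ∑ i, ⟪a n i, t⟫ ^ 2) atTop (𝓝 (covarianceBilin μ t t))) :
    Tendsto (β := ProbabilityMeasure E) (fun n => ⟨rademacherLaw (a n), inferInstance⟩) atTop
      (𝓝 ⟨μ, inferInstance⟩) := by
  refine ProbabilityMeasure.tendsto_of_tendsto_charFun fun t => ?_
  have hsmall : ∀ n i, |⟪a n i, t⟫| ≤ δ n * ‖t‖ := fun n i =>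
    (abs_real_inner_le_norm _ _).trans (mul_le_mul_of_nonneg_right (ha n i) (norm_nonneg t))
  have hcos := tendsto_prod_cos hsmall (by simpa using hδ.mul_const ‖t‖) (hcov t)
  have hchar : charFun μ t = (Real.exp (-(covarianceBilin μ t t / 2)) : ℝ) := by
    rw [IsGaussian.charFun_eq', hμ, inner_zero_right]
    push_cast
    ring_nf
  simpa only [ProbabilityMeasure.coe_mk, charFun_rademacherLaw, hchar, Function.comp_def] using
    (Complex.continuous_ofReal.tendsto _).comp hcos

/-! ### Sheppard's formula for rotation-invariant planar laws -/

section Sheppard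

local instance factZeroLtTwoPi : Fact (0 < 2 * Real.pi) := ⟨Real.two_pi_pos⟩

local notation "𝕋" => AddCircle (2 * Real.pi)

theorem coe_arg_rotation (θ : ℝ) {w : ℂ} (hw : w ≠ 0) :
    ((rotation (Circle.exp θ) w).arg : Real.Angle) = θ + w.arg := by
  have hθ : ((Circle.exp θ : ℂ).arg : Real.Angle) = θ := by
    simpa [Complex.exp_mul_I] using Complex.arg_cos_add_sin_mul_I_coe_angle θ
  rw [rotation_apply, Complex.arg_mul_coe_angle (Circle.coe_ne_zero _) hw, hθ]

theorem measurable_coe_arg : Measurable fun w : ℂ => (w.arg : 𝕋) :=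
  AddCircle.measurable_mk'.comp Complex.measurable_arg

theorem map_arg_eq_haarAddCircle {μ : Measure ℂ} [IsProbabilityMeasure μ]
    (hrot : ∀ a : Circle, μ.map (rotation a) = μ) (h0 : μ {0} = 0) :
    μ.map (fun w => (w.arg : 𝕋)) = AddCircle.haarAddCircle := by
  set ν := μ.map fun w => (w.arg : 𝕋)
  have : IsProbabilityMeasure ν := Measure.isProbabilityMeasure_map measurable_coe_arg.aemeasurable
  have : ν.IsAddLeftInvariant := by
    refine ⟨fun g => ?_⟩
    obtain ⟨θ, rfl⟩ := QuotientAddGroup.mk_surjective g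
    have hadd : (fun w => (θ : 𝕋) + w.arg) =ᵐ[μ]
        fun w => ((rotation (Circle.exp θ) w).arg : 𝕋) := by
      filter_upwards [compl_mem_ae_iff.2 h0] with w hw
      exact (coe_arg_rotation θ hw).symm
    calc ν.map ((θ : 𝕋) + ·)
        = μ.map fun w => (θ : 𝕋) + w.arg :=
          Measure.map_map (measurable_const_add _) measurable_coe_arg
      _ = μ.map fun w => ((rotation (Circle.exp θ) w).arg : 𝕋) :=
          Measure.map_congr hadd
      _ = (μ.map (rotation (Circle.exp θ))).map fun w => (w.arg : 𝕋) :=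
          (Measure.map_map measurable_coe_arg (rotation _).continuous.measurable).symm
      _ = ν := by rw [hrot]
  have : ν.IsAddHaarMeasure := Measure.isAddHaarMeasure_of_isCompact_nonempty_interior ν Set.univ
    isCompact_univ (by simp) (by simp) (by simp)
  exact Measure.isAddHaarMeasure_eq_of_isProbabilityMeasure _ _

theorem measurableSet_lt_cos (b : ℝ) : MeasurableSet {φ : 𝕋 | b < Real.Angle.cos φ} :=
  IsOpen.measurableSet (α := 𝕋) (isOpen_lt continuous_const Real.Angle.continuous_cos)

theorem volume_cos_lt_cos {β : ℝ} (h0 : 0 ≤ β) (hβ : β ≤ Real.pi) :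
    volume {φ : 𝕋 | Real.cos β < Real.Angle.cos φ} = ENNReal.ofReal (2 * β) := by
  have harc : QuotientAddGroup.mk ⁻¹' {φ : 𝕋 | Real.cos β < Real.Angle.cos φ} ∩
      Set.Ioc (-Real.pi) (-Real.pi + 2 * Real.pi) = Set.Ioo (-β) β := by
    ext φ
    have hlt : |φ| ≤ Real.pi → (Real.cos β < Real.cos φ ↔ |φ| < β) := fun hφ => by
      rw [← Real.cos_abs φ]
      exact Real.strictAntiOn_cos.lt_iff_gt ⟨h0, hβ⟩ ⟨abs_nonneg φ, hφ⟩
    change Real.cos β < Real.cos φ ∧ φ ∈ Set.Ioc _ _ ↔ _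
    rw [Set.mem_Ioc, Set.mem_Ioo, ← abs_lt]
    constructor
    · rintro ⟨hcos, hl, hr⟩
      exact (hlt (abs_le.2 ⟨hl.le, by linarith⟩)).1 hcos
    · intro hφ
      have h := abs_lt.1 hφ
      exact ⟨(hlt (hφ.le.trans hβ)).2 hφ, by linarith, by linarith⟩
  rw [AddCircle.add_projection_respects_measure _ (-Real.pi) (measurableSet_lt_cos _), harc,
    Real.volume_Ioo]
  ring_nf

theorem haarAddCircle_cos_lt_cos {β : ℝ} (h0 : 0 ≤ β) (hβ : β ≤ Real.pi) (c : 𝕋) :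
    AddCircle.haarAddCircle ((fun θ => 2 • θ + c) ⁻¹' {φ : 𝕋 | Real.cos β < Real.Angle.cos φ}) =
      ENNReal.ofReal (β / Real.pi) := by
  have hvol := (AddCircle.ergodic_nsmul_add c one_lt_two).toMeasurePreserving.measure_preimage
    (measurableSet_lt_cos (Real.cos β)).nullMeasurableSet
  rw [volume_cos_lt_cos h0 hβ, AddCircle.volume_eq_smul_haarAddCircle, Measure.smul_apply,
    smul_eq_mul, ENNReal.ofReal_mul zero_le_two, ENNReal.ofReal_mul zero_le_two, mul_assoc] at hvol
  rw [ENNReal.ofReal_div_of_pos Real.pi_pos, ENNReal.eq_div_iff (by simp [Real.pi_pos]) (by simp)]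
  exact (ENNReal.mul_right_inj (by simp) (by simp)).1 hvol

theorem inner_eq_norm_mul_norm_mul_cos_arg_sub (u w : ℂ) :
    ⟪u, w⟫ = ‖u‖ * ‖w‖ * Real.cos (w.arg - u.arg) := by
  rw [Complex.inner, Real.cos_sub, Complex.mul_re, Complex.conj_re, Complex.conj_im,
    ← Complex.norm_mul_cos_arg u, ← Complex.norm_mul_cos_arg w, ← Complex.norm_mul_sin_arg u,
    ← Complex.norm_mul_sin_arg w]
  ring

theorem inner_mul_inner_neg_iff {u v w : ℂ} (hu : u ≠ 0) (hv : v ≠ 0) (hw : w ≠ 0) :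
    ⟪u, w⟫ * ⟪v, w⟫ < 0 ↔ Real.cos (InnerProductGeometry.angle u v) <
      Real.cos (2 * w.arg + (Real.pi - u.arg - v.arg)) := by
  have hangle : Real.cos (InnerProductGeometry.angle u v) = Real.cos (v.arg - u.arg) := by
    rw [InnerProductGeometry.cos_angle, inner_eq_norm_mul_norm_mul_cos_arg_sub]
    field_simp
  have hprod : ⟪u, w⟫ * ⟪v, w⟫ = ‖u‖ * ‖v‖ * ‖w‖ ^ 2 / 2 *
      (Real.cos (v.arg - u.arg) - Real.cos (2 * w.arg + (Real.pi - u.arg - v.arg))) := by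
    have hshift : Real.cos (2 * w.arg + (Real.pi - u.arg - v.arg)) =
        -Real.cos (w.arg - u.arg + (w.arg - v.arg)) := by
      rw [← Real.cos_add_pi]
      ring_nf
    have hcos := Real.two_mul_cos_mul_cos (w.arg - u.arg) (w.arg - v.arg)
    rw [sub_sub_sub_cancel_left] at hcos
    rw [inner_eq_norm_mul_norm_mul_cos_arg_sub, inner_eq_norm_mul_norm_mul_cos_arg_sub, hshift]
    linear_combination ‖u‖ * ‖v‖ * ‖w‖ ^ 2 / 2 * hcos
  have hpos : 0 < ‖u‖ * ‖v‖ * ‖w‖ ^ 2 / 2 := by positivity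
  rw [hprod, hangle, ← smul_eq_mul, smul_neg_iff_of_pos_left hpos, sub_neg]

theorem measure_inner_mul_inner_neg {μ : Measure ℂ} [IsProbabilityMeasure μ]
    (hrot : ∀ a : Circle, μ.map (rotation a) = μ) (h0 : μ {0} = 0) {u v : ℂ} (hu : u ≠ 0)
    (hv : v ≠ 0) :
    μ {w | ⟪u, w⟫ * ⟪v, w⟫ < 0} =
      ENNReal.ofReal (InnerProductGeometry.angle u v / Real.pi) := by
  set c := Real.pi - u.arg - v.arg
  rw [← haarAddCircle_cos_lt_cos (InnerProductGeometry.angle_nonneg u v)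
    (InnerProductGeometry.angle_le_pi u v) (c : 𝕋), ← map_arg_eq_haarAddCircle hrot h0,
    Measure.map_apply measurable_coe_arg]
  · refine measure_congr ?_
    filter_upwards [compl_mem_ae_iff.2 h0] with w hw
    have hcoe : (2 • (w.arg : 𝕋) + c : 𝕋) = ((2 * w.arg + c : ℝ) : 𝕋) := by
      rw [two_mul w.arg, two_nsmul]
      rfl
    refine propext ((inner_mul_inner_neg_iff hu hv hw).trans ?_)
    change _ ↔ _ < Real.Angle.cos (2 • (w.arg : 𝕋) + c : 𝕋)
    rw [hcoe]
    exact Iff.rfl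
  · exact ((measurable_const_smul 2).add_const (c : 𝕋)) (measurableSet_lt_cos _)

end Sheppard

/-! ### Signs of weighted sums of random signs -/

theorem stdGaussian_inner_eq_zero {E : Type*} [NormedAddCommGroup E] [InnerProductSpace ℝ E]
    [FiniteDimensional ℝ E] [MeasurableSpace E] [BorelSpace E] {u : E} (hu : u ≠ 0) :
    stdGaussian E {w | ⟪u, w⟫ = 0} = 0 := by
  have hvar : 0 < Var[innerSL ℝ u; stdGaussian E] := by
    rw [variance_dual_stdGaussian, innerSL_apply_norm]
    positivity
  have : NullSingletonClass ((stdGaussian E).map (innerSL ℝ u)) := by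
    rw [IsGaussian.map_eq_gaussianReal]
    exact nullSingletonClass_gaussianReal (Real.toNNReal_pos.2 hvar).ne'
  have hmap := measure_singleton (μ := (stdGaussian E).map (innerSL ℝ u)) (0 : ℝ)
  rwa [Measure.map_apply (by fun_prop) (measurableSet_singleton 0)] at hmap

theorem stdGaussian_inner_mul_inner_neg {u v : ℂ} (hu : u ≠ 0) (hv : v ≠ 0) :
    stdGaussian ℂ {w | ⟪u, w⟫ * ⟪v, w⟫ < 0} =
      ENNReal.ofReal (InnerProductGeometry.angle u v / Real.pi) :=
  measure_inner_mul_inner_neg (fun a => stdGaussian_map (rotation a))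
    (measure_mono_null (by simp) (stdGaussian_inner_eq_zero hu)) hu hv

/-- The pair of real linear functionals `⟪u, ·⟫` and `⟪v, ·⟫`, as the real and imaginary part of
a linear map of the plane. -/
noncomputable def innerPair (u v : ℂ) : ℂ →L[ℝ] ℂ :=
  (Complex.equivRealProdCLM.symm : ℝ × ℝ →L[ℝ] ℂ) ∘L (innerSL ℝ u).prod (innerSL ℝ v)

theorem innerPair_re (u v w : ℂ) : (innerPair u v w).re = ⟪u, w⟫ := by
  simp [innerPair]

theorem innerPair_im (u v w : ℂ) : (innerPair u v w).im = ⟪v, w⟫ := by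
  simp [innerPair]

theorem inner_innerPair (u v w t : ℂ) : ⟪innerPair u v w, t⟫ = ⟪t.re • u + t.im • v, w⟫ := by
  rw [Complex.inner, inner_add_left, real_inner_smul_left, real_inner_smul_left, Complex.mul_re,
    Complex.conj_re, Complex.conj_im, innerPair_re, innerPair_im]
  ring

/-- The joint law of `⟪u, W⟫` and `⟪v, W⟫` for a standard Gaussian vector `W` of the plane. -/
noncomputable def gaussianPair (u v : ℂ) : Measure ℂ :=
  (stdGaussian ℂ).map (innerPair u v)

instance isGaussian_gaussianPair (u v : ℂ) : IsGaussian (gaussianPair u v) :=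
  isGaussian_map (innerPair u v)

theorem integral_id_gaussianPair (u v : ℂ) : (gaussianPair u v)[id] = 0 := by
  rw [gaussianPair, integral_map (by fun_prop) (by fun_prop)]
  simp only [id]
  rw [ContinuousLinearMap.integral_comp_id_comm IsGaussian.integrable_id,
    integral_id_stdGaussian, map_zero]

theorem covarianceBilin_gaussianPair (u v t : ℂ) : covarianceBilin (gaussianPair u v) t t =
    t.re ^ 2 * ‖u‖ ^ 2 + 2 * (t.re * t.im) * ⟪u, v⟫ + t.im ^ 2 * ‖v‖ ^ 2 := by
  have hadj : (innerPair u v).adjoint t = t.re • u + t.im • v := ext_inner_right ℝ fun w => by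
    rw [ContinuousLinearMap.adjoint_inner_left, real_inner_comm, inner_innerPair]
  rw [gaussianPair, covarianceBilin_map IsGaussian.memLp_two_id, hadj,
    covarianceBilin_stdGaussian, innerSL_apply_apply, real_inner_self_eq_norm_sq,
    norm_add_sq_real, norm_smul, norm_smul, mul_pow, mul_pow, real_inner_smul_left,
    real_inner_smul_right, Real.norm_eq_abs, Real.norm_eq_abs, sq_abs, sq_abs]
  ring

theorem signBit_ne_of_mul_neg (tie : Bool) {a b : ℝ} (h : a * b < 0) :
    signBit tie a ≠ signBit tie b := by
  rcases mul_neg_iff.1 h with ⟨ha, hb⟩ | ⟨ha, hb⟩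
  · simp [signBit, ha, hb, hb.le.not_gt]
  · simp [signBit, ha, hb, ha.le.not_gt]

theorem mul_nonpos_of_signBit_ne {tie : Bool} {a b : ℝ} (h : signBit tie a ≠ signBit tie b) :
    a * b ≤ 0 := by
  by_contra! hpos
  rcases mul_pos_iff.1 hpos with ⟨ha, hb⟩ | ⟨ha, hb⟩
  · simp [signBit, ha, hb] at h
  · simp [signBit, ha, hb, ha.le.not_gt, hb.le.not_gt] at h

theorem signBit_mul_of_pos (tie : Bool) {c : ℝ} (hc : 0 < c) (t : ℝ) :
    signBit tie (c * t) = signBit tie t := by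
  simp only [signBit, ← smul_eq_mul, smul_pos_iff_of_pos_left hc, smul_neg_iff_of_pos_left hc]

theorem measurable_signBit (tie : Bool) : Measurable (signBit tie) :=
  Measurable.ite measurableSet_Ioi measurable_const
    (Measurable.ite measurableSet_Iio measurable_const measurable_const)

/-- The set of points of the plane whose coordinates have different signs. -/
def signDisagreement (tie : Bool) : Set ℂ :=
  {w | signBit tie w.re ≠ signBit tie w.im}

theorem measurableSet_signDisagreement (tie : Bool) : MeasurableSet (signDisagreement tie) :=
  (measurableSet_eq_fun ((measurable_signBit tie).comp Complex.measurable_re)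
    ((measurable_signBit tie).comp Complex.measurable_im)).compl

theorem frontier_signDisagreement_subset (tie : Bool) :
    frontier (signDisagreement tie) ⊆ {w | w.re * w.im = 0} := by
  have hopen : {w : ℂ | w.re * w.im < 0} ⊆ interior (signDisagreement tie) :=
    interior_maximal (fun w hw => signBit_ne_of_mul_neg tie hw)
      (isOpen_lt (by fun_prop) continuous_const)
  have hclosed : closure (signDisagreement tie) ⊆ {w | w.re * w.im ≤ 0} :=
    closure_minimal (fun w hw => mul_nonpos_of_signBit_ne hw)
      (isClosed_le (by fun_prop) continuous_const)
  exact fun w hw => (hclosed hw.1).antisymm (not_lt.1 fun h => hw.2 (hopen h))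

theorem gaussianPair_re_mul_im_eq_zero {u v : ℂ} (hu : u ≠ 0) (hv : v ≠ 0) :
    gaussianPair u v {w | w.re * w.im = 0} = 0 := by
  rw [gaussianPair,
    Measure.map_apply (by fun_prop) (measurableSet_eq_fun (by fun_prop) (by fun_prop))]
  refine measure_mono_null (fun w hw => ?_)
    (measure_union_null (stdGaussian_inner_eq_zero hu) (stdGaussian_inner_eq_zero hv))
  simpa [innerPair_re, innerPair_im] using hw

theorem gaussianPair_signDisagreement (tie : Bool) {u v : ℂ} (hu : u ≠ 0) (hv : v ≠ 0) :
    gaussianPair u v (signDisagreement tie) =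
      ENNReal.ofReal (InnerProductGeometry.angle u v / Real.pi) := by
  have hneg : signDisagreement tie =ᵐ[gaussianPair u v] {w : ℂ | w.re * w.im < 0} := by
    filter_upwards [compl_mem_ae_iff.2 (gaussianPair_re_mul_im_eq_zero hu hv)] with w hw
    exact propext ⟨fun h => (mul_nonpos_of_signBit_ne h).lt_of_ne hw, signBit_ne_of_mul_neg tie⟩
  rw [measure_congr hneg, gaussianPair, Measure.map_apply (by fun_prop)
    (measurableSet_lt (by fun_prop) measurable_const), ← stdGaussian_inner_mul_inner_neg hu hv]
  simp only [Set.preimage_ofPred_eq, innerPair_re, innerPair_im]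

theorem tendsto_expect_signBit_ne (tie : Bool) {ι : ℕ → Type*} [∀ n, Fintype (ι n)]
    [∀ n, DecidableEq (ι n)] {k l : ∀ n, ι n → ℝ} {δ : ℕ → ℝ} {u v : ℂ} (hu : u ≠ 0) (hv : v ≠ 0)
    (hδ : Tendsto δ atTop (𝓝 0)) (hk : ∀ n i, |k n i| ≤ δ n) (hl : ∀ n i, |l n i| ≤ δ n)
    (hkk : Tendsto (fun n => ∑ i, k n i ^ 2) atTop (𝓝 (‖u‖ ^ 2)))
    (hkl : Tendsto (fun n => ∑ i, k n i * l n i) atTop (𝓝 ⟪u, v⟫))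
    (hll : Tendsto (fun n => ∑ i, l n i ^ 2) atTop (𝓝 (‖v‖ ^ 2))) :
    Tendsto (fun n => 𝔼 f : ι n → Bool,
      if signBit tie (∑ i, k n i * pmOne (f i)) ≠ signBit tie (∑ i, l n i * pmOne (f i))
      then (1 : ℝ) else 0) atTop (𝓝 (InnerProductGeometry.angle u v / Real.pi)) := by
  let a : ∀ n, ι n → ℂ := fun n i => ⟨k n i, l n i⟩
  have hnorm : ∀ n i, ‖a n i‖ ≤ δ n + δ n := fun n i =>
    (Complex.norm_le_abs_re_add_abs_im _).trans (add_le_add (hk n i) (hl n i))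
  have hcov : ∀ t, Tendsto (fun n => ∑ i, ⟪a n i, t⟫ ^ 2) atTop
      (𝓝 (covarianceBilin (gaussianPair u v) t t)) := fun t => by
    have hexp : ∀ n, ∑ i, ⟪a n i, t⟫ ^ 2 = t.re ^ 2 * ∑ i, k n i ^ 2 +
        2 * (t.re * t.im) * ∑ i, k n i * l n i + t.im ^ 2 * ∑ i, l n i ^ 2 := fun n => by
      simp only [Finset.mul_sum, ← Finset.sum_add_distrib, a, Complex.inner, Complex.mul_re,
        Complex.conj_re, Complex.conj_im]
      exact Finset.sum_congr rfl fun i _ => by ring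
    simp only [hexp, covarianceBilin_gaussianPair]
    exact ((hkk.const_mul _).add (hkl.const_mul _)).add (hll.const_mul _)
  have hclt := tendsto_rademacherLaw (integral_id_gaussianPair u v) hnorm
    (by simpa using hδ.add hδ) hcov
  have hport := ProbabilityMeasure.tendsto_measure_of_null_frontier_of_tendsto' hclt
    (measure_mono_null (frontier_signDisagreement_subset tie)
      (gaussianPair_re_mul_im_eq_zero hu hv))
  have hreal := (ENNReal.tendsto_toReal (measure_ne_top (gaussianPair u v) _)).comp hport
  rw [gaussianPair_signDisagreement tie hu hv, ENNReal.toReal_ofReal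
    (div_nonneg (InnerProductGeometry.angle_nonneg u v) Real.pi_pos.le)] at hreal
  refine hreal.congr fun n => ?_
  change (rademacherLaw (a n)).real _ = _
  rw [rademacherLaw_real_apply _ (measurableSet_signDisagreement tie)]
  refine Finset.expect_congr rfl fun f _ => ?_
  simp [Set.indicator, signDisagreement, a, mul_comm]

/-! ### The noise kernel -/

section NoiseKernel

variable {n : ℕ}

theorem abs_noiseKernel_le (r : ℝ) (x z : Fin n → Bool) :
    |noiseKernel r x z| ≤ ((1 + |r|) / 2) ^ n := by
  have hfactor : ∀ i, |if z i = x i then (1 + r) / 2 else (1 - r) / 2| ≤ (1 + |r|) / 2 :=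
    fun i => by
      split_ifs <;> rw [abs_le] <;> constructor <;> linarith [neg_abs_le r, le_abs_self r]
  rw [noiseKernel, Finset.abs_prod]
  exact (Finset.prod_le_prod (fun _ _ => abs_nonneg _) fun i _ => hfactor i).trans_eq
    (Fin.prod_const n _)

theorem noiseKernel_comm (r : ℝ) (x z : Fin n → Bool) : noiseKernel r x z = noiseKernel r z x := by
  simp only [noiseKernel, eq_comm]

theorem noiseKernel_self (r : ℝ) (x : Fin n → Bool) : noiseKernel r x x = ((1 + r) / 2) ^ n := by
  simp only [noiseKernel, if_true, Fin.prod_const]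

theorem one_add_mul_noiseKernel_flipBit (r : ℝ) (x : Fin n → Bool) (i : Fin n) :
    (1 + r) * noiseKernel r x (flipBit i x) = (1 - r) * noiseKernel r x x := by
  have hne : ∀ j ∈ ({i} : Finset (Fin n))ᶜ, flipBit i x j = x j := fun j hj => by
    simp_all [flipBit]
  have hi : flipBit i x i ≠ x i := by simp [flipBit]
  have hrest := Finset.prod_congr (f := fun j => if flipBit i x j = x j then (1 + r) / 2 else
    (1 - r) / 2) rfl fun j hj => if_pos (hne j hj)
  rw [noiseKernel, noiseKernel, Fintype.prod_eq_mul_prod_compl i, Fintype.prod_eq_mul_prod_compl i,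
    hrest, if_neg hi]
  simp only [if_true]
  ring

theorem sum_noiseKernel_mul_noiseKernel (r s : ℝ) (x y : Fin n → Bool) :
    ∑ z, noiseKernel r x z * noiseKernel s z y = noiseKernel (r * s) x y := by
  simp only [noiseKernel, ← Finset.prod_mul_distrib]
  rw [← Fintype.prod_sum fun i b => (if b = x i then (1 + r) / 2 else (1 - r) / 2) *
    if y i = b then (1 + s) / 2 else (1 - s) / 2]
  refine Finset.prod_congr rfl fun i _ => ?_
  cases x i <;> cases y i <;> simp <;> ring

/-- The noise kernel at `x`, scaled to be a unit vector in `ℓ²`. -/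
noncomputable def normalizedKernel (r : ℝ) (x z : Fin n → Bool) : ℝ :=
  noiseKernel r x z / √((1 + r ^ 2) / 2) ^ n

theorem abs_normalizedKernel_le (r : ℝ) (x z : Fin n → Bool) :
    |normalizedKernel r x z| ≤ ((1 + |r|) / 2 / √((1 + r ^ 2) / 2)) ^ n := by
  rw [normalizedKernel, abs_div, abs_of_nonneg (a := √_ ^ n) (by positivity), div_pow]
  gcongr
  exact abs_noiseKernel_le r x z

theorem sum_normalizedKernel_mul (r : ℝ) (x y : Fin n → Bool) :
    ∑ z, normalizedKernel r x z * normalizedKernel r y z =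
      noiseKernel (r ^ 2) x y / noiseKernel (r ^ 2) x x := by
  have hscale : (√((1 + r ^ 2) / 2) ^ n) ^ 2 = noiseKernel (r ^ 2) x x := by
    rw [noiseKernel_self, pow_right_comm, Real.sq_sqrt (by positivity)]
  simp only [normalizedKernel, div_mul_div_comm, ← Finset.sum_div, noiseKernel_comm r y]
  rw [sum_noiseKernel_mul_noiseKernel, ← sq, ← sq, hscale]

theorem sum_normalizedKernel_sq (r : ℝ) (x : Fin n → Bool) :
    ∑ z, normalizedKernel r x z ^ 2 = 1 := by
  have hpos : noiseKernel (r ^ 2) x x ≠ 0 := by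
    rw [noiseKernel_self]
    positivity
  simp only [sq (normalizedKernel r x _), sum_normalizedKernel_mul, div_self hpos]

theorem sum_normalizedKernel_mul_flipBit (r : ℝ) (x : Fin n → Bool) (i : Fin n) :
    ∑ z, normalizedKernel r x z * normalizedKernel r (flipBit i x) z =
      (1 - r ^ 2) / (1 + r ^ 2) := by
  have hpos : noiseKernel (r ^ 2) x x ≠ 0 := by
    rw [noiseKernel_self]
    positivity
  rw [sum_normalizedKernel_mul, div_eq_div_iff hpos (by positivity), mul_comm,
    one_add_mul_noiseKernel_flipBit]

theorem signBit_sum_normalizedKernel (tie : Bool) (r : ℝ) (x : Fin n → Bool)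
    (g : (Fin n → Bool) → ℝ) :
    signBit tie (∑ z, normalizedKernel r x z * g z) = signBit tie (noiseOp r g x) := by
  have hpos : 0 < (√((1 + r ^ 2) / 2) ^ n)⁻¹ := by positivity
  rw [← signBit_mul_of_pos tie hpos (noiseOp r g x), noiseOp, Finset.mul_sum]
  congr 1
  exact Finset.sum_congr rfl fun z _ => by rw [normalizedKernel]; ring

end NoiseKernel

theorem tendsto_normalizedKernel_bound {r : ℝ} (hr : |r| ≠ 1) :
    Tendsto (fun n : ℕ => ((1 + |r|) / 2 / √((1 + r ^ 2) / 2)) ^ n) atTop (𝓝 0) := by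
  refine tendsto_pow_atTop_nhds_zero_of_lt_one (by positivity) ?_
  rw [div_lt_one (by positivity)]
  refine Real.lt_sqrt_of_sq_lt ?_
  have hgap : 0 < (1 - |r|) ^ 2 := sq_pos_of_ne_zero (sub_ne_zero.2 hr.symm)
  rw [← sq_abs r]
  linarith

theorem exists_norm_eq_one_and_inner_eq {ρ : ℝ} (h₁ : -1 ≤ ρ) (h₂ : ρ ≤ 1) :
    ∃ u v : ℂ, ‖u‖ = 1 ∧ ‖v‖ = 1 ∧ ⟪u, v⟫ = ρ :=
  ⟨1, Complex.exp (Real.arccos ρ * Complex.I), norm_one, Complex.norm_exp_ofReal_mul_I _, by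
    simp [Complex.inner, Complex.exp_ofReal_mul_I_re, Real.cos_arccos h₁ h₂]⟩

theorem tendsto_flipProb_optPredictor (tie : Bool) {p : ℝ} (hp : |1 - 2 * p| ≠ 1)
    (x : ∀ n, Fin (n + 1) → Bool) (i : ∀ n, Fin (n + 1)) :
    Tendsto (fun n => flipProb (optPredictor tie p) (x n) (i n)) atTop
      (𝓝 (Real.arccos (2 * p * (1 - p) / (p ^ 2 + (1 - p) ^ 2)) / Real.pi)) := by
  set r := 1 - 2 * p with hr
  have hcorr : (1 - r ^ 2) / (1 + r ^ 2) = 2 * p * (1 - p) / (p ^ 2 + (1 - p) ^ 2) := by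
    have hQ : p ^ 2 + (1 - p) ^ 2 = (1 + r ^ 2) / 2 := by rw [hr]; ring
    rw [hQ, hr]
    field_simp
    ring
  obtain ⟨u, v, hu, hv, huv⟩ := exists_norm_eq_one_and_inner_eq (ρ := (1 - r ^ 2) / (1 + r ^ 2))
    (by rw [le_div_iff₀ (by positivity)]; linarith)
    (by rw [div_le_one (by positivity)]; linarith [sq_nonneg r])
  have hlim := tendsto_expect_signBit_ne tie (u := u) (v := v)
    (k := fun n => normalizedKernel r (x n))
    (l := fun n => normalizedKernel r (flipBit (i n) (x n)))
    (norm_ne_zero_iff.1 (by simp [hu])) (norm_ne_zero_iff.1 (by simp [hv]))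
    ((tendsto_add_atTop_iff_nat 1).2 (tendsto_normalizedKernel_bound hp))
    (fun n => abs_normalizedKernel_le r _) (fun n => abs_normalizedKernel_le r _)
    (by simp [sum_normalizedKernel_sq, hu])
    (by simp [sum_normalizedKernel_mul_flipBit, huv])
    (by simp [sum_normalizedKernel_sq, hv])
  simpa only [flipProb, optPredictor, ← hr, signBit_sum_normalizedKernel,
    InnerProductGeometry.angle, hu, hv, huv, mul_one, div_one, hcorr] using hlim

/-! ### Degenerate noise rates -/

section Degenerate

variable {n : ℕ}

theorem signBit_pmOne (tie b : Bool) : signBit tie (pmOne b) = b := by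
  cases b <;> simp [signBit, pmOne]

theorem noiseOp_zero (g : (Fin n → Bool) → ℝ) (x y : Fin n → Bool) :
    noiseOp 0 g x = noiseOp 0 g y := by
  simp only [noiseOp, noiseKernel, add_zero, sub_zero, ite_self]

theorem noiseOp_one (g : (Fin n → Bool) → ℝ) (x : Fin n → Bool) : noiseOp 1 g x = g x := by
  rw [noiseOp, Fintype.sum_eq_single x fun z hz => ?_, noiseKernel_self]
  · norm_num
  · obtain ⟨i, hi⟩ := Function.ne_iff.1 hz
    rw [noiseKernel, Finset.prod_eq_zero (Finset.mem_univ i) (by simp [hi]), zero_mul]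

theorem noiseOp_neg (r : ℝ) (g : (Fin n → Bool) → ℝ) (x : Fin n → Bool) :
    noiseOp (-r) g x = noiseOp r g xᶜ := by
  have hfactor : ∀ a b : Bool, (if b = a then (1 + -r) / 2 else (1 - -r) / 2) =
      if b = !a then (1 + r) / 2 else (1 - r) / 2 := fun a b => by
    cases a <;> cases b <;> simp [sub_eq_add_neg]
  simp only [noiseOp, noiseKernel, hfactor, Pi.compl_apply, Bool.compl_eq_bnot]

theorem expect_avgSensitivity_optPredictor_of_abs_eq_one (tie : Bool) {p : ℝ}
    (hp : |1 - 2 * p| = 1) :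
    𝔼 f : BoolFun n, avgSensitivity (optPredictor tie p f) = (n : ℝ) / 2 := by
  rcases eq_or_eq_neg_of_abs_eq hp with h | h
  · exact expect_avgSensitivity_comp Function.injective_id fun f x => by
      rw [optPredictor, h, noiseOp_one, signBit_pmOne, id]
  · exact expect_avgSensitivity_comp compl_injective fun f x => by
      rw [optPredictor, h, noiseOp_neg, noiseOp_one, signBit_pmOne]

theorem avgSensitivity_optPredictor_half (tie : Bool) (f : BoolFun n) :
    avgSensitivity (optPredictor tie (1 / 2) f) = 0 := by
  have hconst : ∀ x y, optPredictor tie (1 / 2) f x = optPredictor tie (1 / 2) f y := fun x y => by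
    have hr : (1 - 2 * (1 / 2) : ℝ) = 0 := by norm_num
    rw [optPredictor, optPredictor, hr, noiseOp_zero]
  have hsens : ∀ x, sensitivityAt (optPredictor tie (1 / 2) f) x = 0 := fun x =>
    Finset.card_eq_zero.2 (Finset.filter_false_of_mem fun i _ => not_not.2 (hconst _ _))
  simp only [avgSensitivity, hsens, Nat.cast_zero, Finset.expect_const_zero]

end Degenerate

/-! ### Asymptotics -/

theorem tendsto_expect_avgSensitivity_div (tie : Bool) (p : ℝ) :
    Tendsto (fun n : ℕ => (𝔼 f : BoolFun n, avgSensitivity (optPredictor tie p f)) / n) atTop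
      (𝓝 (Real.arccos (2 * p * (1 - p) / (p ^ 2 + (1 - p) ^ 2)) / Real.pi)) := by
  rw [← tendsto_add_atTop_iff_nat 1]
  by_cases hp : |1 - 2 * p| = 1
  · have hzero : 2 * p * (1 - p) = 0 := by
      have hsq := sq_eq_sq_iff_abs_eq_abs (1 - 2 * p) 1 |>.2 (by rw [hp, abs_one])
      linear_combination -hsq / 2
    have hhalf : Real.arccos (2 * p * (1 - p) / (p ^ 2 + (1 - p) ^ 2)) / Real.pi = 1 / 2 := by
      rw [hzero, zero_div, Real.arccos_zero]
      field_simp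
    rw [hhalf]
    refine tendsto_const_nhds.congr fun n => ?_
    rw [expect_avgSensitivity_optPredictor_of_abs_eq_one tie hp]
    field_simp
  · refine Tendsto.congr (fun n => ?_) <| tendsto_expect_of_forall_tendsto
      (F := fun n (q : (Fin (n + 1) → Bool) × Fin (n + 1)) =>
        flipProb (optPredictor tie p) q.1 q.2)
      fun q => tendsto_flipProb_optPredictor tie hp (fun n => (q n).1) fun n => (q n).2
    rw [expect_avgSensitivity, mul_div_cancel_left₀ _ (Nat.cast_ne_zero.2 n.succ_ne_zero)]

theorem arccos_correlation_ne_zero {p : ℝ} (hp : p ≠ 1 / 2) :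
    Real.arccos (2 * p * (1 - p) / (p ^ 2 + (1 - p) ^ 2)) ≠ 0 := by
  have hgap : 0 < (1 - 2 * p) ^ 2 := sq_pos_of_ne_zero fun h => hp (by linarith)
  rw [Ne, Real.arccos_eq_zero, not_le, div_lt_one (by nlinarith)]
  linarith

theorem isEquivalent_expect_avgSensitivity_optPredictor (tie : Bool) (p : ℝ) :
    Asymptotics.IsEquivalent atTop
      (fun n : ℕ => 𝔼 f : BoolFun n, avgSensitivity (optPredictor tie p f))
      (fun n : ℕ => (n : ℝ) / Real.pi *
        Real.arccos (2 * p * (1 - p) / (p ^ 2 + (1 - p) ^ 2))) := by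
  rcases eq_or_ne p (1 / 2) with rfl | hp
  · refine EventuallyEq.isEquivalent (Eventually.of_forall fun n => ?_)
    simp only [avgSensitivity_optPredictor_half]
    norm_num
  · have hdiv := (Asymptotics.isEquivalent_const_iff_tendsto
      (div_ne_zero (arccos_correlation_ne_zero hp) Real.pi_ne_zero)).2
      (tendsto_expect_avgSensitivity_div tie p)
    have hmul := (Asymptotics.IsEquivalent.refl (u := fun n : ℕ => (n : ℝ))).mul hdiv
    refine (hmul.congr_left ?_).congr_right (Eventually.of_forall fun n => ?_)
    · filter_upwards [eventually_ne_atTop 0] with n hn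
      exact mul_div_cancel₀ _ (Nat.cast_ne_zero.2 hn)
    · simp only [Pi.mul_apply, Function.const_apply]
      ring

theorem expect_avgSensitivity_eq_half (n : ℕ) : 𝔼 f : BoolFun n, avgSensitivity f = (n : ℝ) / 2 :=
  expect_avgSensitivity_comp Function.injective_id fun _ _ => rfl

theorem eventually_expect_avgSensitivity_optPredictor_lt (tie : Bool) {p : ℝ} (h₀ : 0 < p)
    (h₁ : p < 1) :
    ∀ᶠ n : ℕ in atTop, 𝔼 f : BoolFun n, avgSensitivity (optPredictor tie p f) <
      𝔼 f : BoolFun n, avgSensitivity f := by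
  have hcorr : 0 < 2 * p * (1 - p) / (p ^ 2 + (1 - p) ^ 2) := by
    have := sub_pos.2 h₁
    positivity
  have hlt : Real.arccos (2 * p * (1 - p) / (p ^ 2 + (1 - p) ^ 2)) / Real.pi < 1 / 2 := by
    rw [div_lt_iff₀ Real.pi_pos]
    linarith [Real.arccos_lt_pi_div_two.2 hcorr]
  filter_upwards [(tendsto_expect_avgSensitivity_div tie p).eventually_lt_const hlt,
    eventually_gt_atTop 0] with n hn hn₀
  rw [div_lt_iff₀ (Nat.cast_pos.2 hn₀)] at hn
  rw [expect_avgSensitivity_eq_half]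
  linarith

theorem proposition2_general (tie : Bool) :
    (∀ p : ℝ,
      Asymptotics.IsEquivalent atTop
        (fun n : ℕ => 𝔼 f : BoolFun n, avgSensitivity (optPredictor tie p f))
        (fun n : ℕ => (n : ℝ) / Real.pi *
          Real.arccos (2 * p * (1 - p) / (p ^ 2 + (1 - p) ^ 2)))) ∧
    (∀ n : ℕ, (𝔼 f : BoolFun n, avgSensitivity f) = (n : ℝ) / 2) ∧
    (∀ p : ℝ, 0 < p → p < 1 →
      ∀ᶠ n : ℕ in atTop,
        (𝔼 f : BoolFun n, avgSensitivity (optPredictor tie p f)) <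
          𝔼 f : BoolFun n, avgSensitivity f) :=
  ⟨isEquivalent_expect_avgSensitivity_optPredictor tie, expect_avgSensitivity_eq_half,
    fun _ => eventually_expect_avgSensitivity_optPredictor_lt tie⟩

theorem proposition2 (tie : Bool) :
    (∀ p : ℝ, 0 ≤ p → p ≤ 1 →
      Asymptotics.IsEquivalent Filter.atTop
        (fun n : ℕ => 𝔼 f : BoolFun n, avgSensitivity (optPredictor tie p f))
        (fun n : ℕ => (n : ℝ) / Real.pi *
          Real.arccos (2 * p * (1 - p) / (p ^ 2 + (1 - p) ^ 2)))) ∧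
    (∀ n : ℕ, (𝔼 f : BoolFun n, avgSensitivity f) = (n : ℝ) / 2) ∧
    (∀ p : ℝ, 0 < p → p ≤ 1 / 2 →
      ∀ᶠ n : ℕ in Filter.atTop,
        (𝔼 f : BoolFun n, avgSensitivity (optPredictor tie p f)) <
          𝔼 f : BoolFun n, avgSensitivity f) := by
  obtain ⟨hequiv, hhalf, hlt⟩ := proposition2_general tie
  exact ⟨fun p _ _ => hequiv p, hhalf, fun p h₀ h₁ => hlt p h₀ (by linarith)⟩
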